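/- Let $K$ be a nonarchimedean local field (of any characteristic) with absolute value $|\cdot|$ and ring of integers $\mathcal O$, and let $C(\mathcal O,K)$ be the ring of continuous functions $f\colon\mathcal O\to K$, topologized by the sup-norm $\|f\|=\sup_{x\in\mathcal O}|f(x)|$. Then every closed prime ideal of $C(\mathcal O,K)$ is a maximal ideal, and it is of the form $M_x := \{f\in C(\mathcal O,K) : f(x)=0\}$ for some $x\in\mathcal O$. -/

import Mathlib

open scoped ValuativeRel Topology

/-- The topology of `C(𝒪, K)` given by the sup-norm `‖f‖ = sup_{x ∈ 𝒪} ‖f x‖`, where `K` is a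
nonarchimedean local field, `‖·‖` is an absolute value on `K` that defines its topology, and
`𝒪 = 𝒪[K]` is the (compact) ring of integers of `K`. -/
noncomputable abbrev supNormTopology (K : Type*) [NormedField K] [ValuativeRel K]
    [IsNonarchimedeanLocalField K] : TopologicalSpace C(𝒪[K], K) :=
  (inferInstance : NormedCommRing C(𝒪[K], K)).toMetricSpace.toUniformSpace.toTopologicalSpace

/-- The set `M_x = {f : f(x) = 0}` of the continuous functions on `𝒪[K]` that vanish at `x`, as an
ideal of `C(𝒪[K], K)`. -/
def vanishingIdealAt {K : Type*} [NormedField K] [ValuativeRel K]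
    [IsNonarchimedeanLocalField K] (x : 𝒪[K]) : Ideal C(𝒪[K], K) where
  carrier := {f | f x = 0}
  zero_mem' := by simp
  add_mem' := by
    intro f g hf hg
    simp only [Set.mem_ofPred_eq] at hf hg
    simp [hf, hg]
  smul_mem' := by
    intro c f hf
    simp only [Set.mem_ofPred_eq] at hf
    simp [hf]

/-! Indicators of clopen sets are idempotent, so a prime `P` contains `1_U` or `1 - 1_U`. By
compactness some `x` has no clopen neighbourhood `U` with `1_U ∈ P`; otherwise `1 ∈ P`. If `f x =
0`, then `f` is small on some clopen `U ∋ x`, so `f * (1 - 1_U) ∈ P` is uniformly close to `f`, and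
closedness gives `f ∈ P`. Thus `M_x ⊆ P`, with equality since `M_x` is maximal. -/

section ClopenIndicator

variable {X K : Type*} [TopologicalSpace X] [NormedField K]

/-- The indicator function of a clopen set, as a continuous function. -/
noncomputable def clopenIndicator (K : Type*) [NormedField K] {U : Set X} (hU : IsClopen U) :
    C(X, K) :=
  (LocallyConstant.charFn K hU : C(X, K))

theorem clopenIndicator_of_mem {U : Set X} (hU : IsClopen U) {x : X} (hx : x ∈ U) :
    clopenIndicator K hU x = 1 :=
  (LocallyConstant.charFn_eq_one K x hU).mpr hx

theorem clopenIndicator_of_notMem {U : Set X} (hU : IsClopen U) {x : X} (hx : x ∉ U) :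
    clopenIndicator K hU x = 0 :=
  (LocallyConstant.charFn_eq_zero K x hU).mpr hx

theorem clopenIndicator_union {U V : Set X} (hU : IsClopen U) (hV : IsClopen V) :
    clopenIndicator K (hU.union hV) =
      clopenIndicator K hU + (1 - clopenIndicator K hU) * clopenIndicator K hV := by
  ext x
  by_cases hxU : x ∈ U
  · simp [clopenIndicator_of_mem, hxU]
  · by_cases hxV : x ∈ V <;>
      simp [clopenIndicator_of_mem, clopenIndicator_of_notMem, hxU, hxV]

/-- A prime ideal contains the indicator of a clopen set or that of its complement. -/
theorem one_sub_clopenIndicator_mem {P : Ideal C(X, K)} (hP : P.IsPrime) {U : Set X}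
    (hU : IsClopen U) (h : clopenIndicator K hU ∉ P) : 1 - clopenIndicator K hU ∈ P := by
  refine (hP.mem_or_mem (x := clopenIndicator K hU) ?_).resolve_left h
  convert P.zero_mem
  ext x
  by_cases hx : x ∈ U <;> simp [clopenIndicator_of_mem, clopenIndicator_of_notMem, hx]

/-- On a compact space, a proper ideal of continuous functions has a point none of whose clopen
neighbourhoods has its indicator in the ideal. -/
theorem exists_forall_clopenIndicator_notMem [CompactSpace X] {P : Ideal C(X, K)} (hP : P ≠ ⊤) :
    ∃ x : X, ∀ (U : Set X) (hU : IsClopen U), x ∈ U → clopenIndicator K hU ∉ P := by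
  by_contra! hcon
  obtain ⟨V, hV, hsub, hmem⟩ : ∃ (V : Set X) (hV : IsClopen V),
      Set.univ ⊆ V ∧ clopenIndicator K hV ∈ P := by
    -- Compactness extends this property of `s` from small neighbourhoods to the whole space.
    refine isCompact_univ.induction_on
      (p := fun s => ∃ (V : Set X) (hV : IsClopen V), s ⊆ V ∧ clopenIndicator K hV ∈ P) ?_ ?_ ?_ ?_
    · refine ⟨∅, isClopen_empty, subset_rfl, ?_⟩
      convert P.zero_mem
      ext x
      simp [clopenIndicator_of_notMem]
    · rintro s t hst ⟨V, hV, htV, hmem⟩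
      exact ⟨V, hV, hst.trans htV, hmem⟩
    · rintro s t ⟨U, hU, hsU, hUP⟩ ⟨V, hV, htV, hVP⟩
      refine ⟨U ∪ V, hU.union hV, Set.union_subset_union hsU htV, ?_⟩
      rw [clopenIndicator_union hU hV]
      exact P.add_mem hUP (P.mul_mem_left _ hVP)
    · intro x _
      obtain ⟨U, hU, hxU, hUP⟩ := hcon x
      exact ⟨U, mem_nhdsWithin_of_mem_nhds (hU.isOpen.mem_nhds hxU), U, hU, subset_rfl, hUP⟩
  refine hP ((Ideal.eq_top_iff_one P).mpr ?_)
  convert hmem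
  ext x
  simp [clopenIndicator_of_mem hV (hsub (Set.mem_univ x))]

/-- On a compact Hausdorff totally disconnected space, a closed prime ideal of continuous functions
contains all functions vanishing at some point. -/
theorem exists_forall_mem_of_isClosed_of_isPrime [CompactSpace X] [T2Space X]
    [TotallyDisconnectedSpace X] {P : Ideal C(X, K)} (hP : P.IsPrime)
    (hclosed : IsClosed (P : Set C(X, K))) : ∃ x : X, ∀ f : C(X, K), f x = 0 → f ∈ P := by
  obtain ⟨x, hx⟩ := exists_forall_clopenIndicator_notMem hP.ne_top
  refine ⟨x, fun f hf => hclosed.closure_subset (Metric.mem_closure_iff.mpr fun ε hε => ?_)⟩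
  obtain ⟨U, hU, hxU, hUf⟩ := compact_exists_isClopen_in_isOpen (x := x)
    (isOpen_lt (map_continuous f).norm continuous_const : IsOpen {y | ‖f y‖ < ε}) (by simpa [hf])
  -- This differs from `f` by `f * 1_U`, which is below `ε` on `U` and zero elsewhere.
  refine ⟨f * (1 - clopenIndicator K hU),
    P.mul_mem_left _ (one_sub_clopenIndicator_mem hP hU (hx U hU hxU)), ?_⟩
  rw [ContinuousMap.dist_lt_iff hε]
  intro y
  by_cases hy : y ∈ U
  · simpa [clopenIndicator_of_mem, hy] using hUf hy
  · simpa [clopenIndicator_of_notMem, hy] using hε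

end ClopenIndicator

section LocalField

/-- Open valuation balls around zero are additive subgroups. -/
theorem IsValuativeTopology.nonarchimedeanRing (R : Type*) [CommRing R] [ValuativeRel R]
    [TopologicalSpace R] [IsValuativeTopology R] [IsTopologicalRing R] : NonarchimedeanRing R where
  is_nonarchimedean U hU := by
    obtain ⟨γ, -, hγ⟩ := (IsValuativeTopology.hasBasis_nhds_zero R).mem_iff.mp hU
    exact ⟨⟨(ValuativeRel.valuation R).ltAddSubgroup γ, AddSubgroup.isOpen_of_mem_nhds _
      ((IsValuativeTopology.hasBasis_nhds_zero R).mem_of_mem trivial)⟩, hγ⟩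

theorem IsNonarchimedeanLocalField.totallyDisconnectedSpace (K : Type*) [Field K] [ValuativeRel K]
    [TopologicalSpace K] [IsNonarchimedeanLocalField K] [T2Space K] :
    TotallyDisconnectedSpace K := by
  have := IsValuativeTopology.nonarchimedeanRing K
  infer_instance

theorem mem_vanishingIdealAt {K : Type*} [NormedField K] [ValuativeRel K]
    [IsNonarchimedeanLocalField K] {x : 𝒪[K]} {f : C(𝒪[K], K)} :
    f ∈ vanishingIdealAt x ↔ f x = 0 :=
  Iff.rfl

theorem vanishingIdealAt_isMaximal {K : Type*} [NormedField K] [ValuativeRel K]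
    [IsNonarchimedeanLocalField K] (x : 𝒪[K]) : (vanishingIdealAt x).IsMaximal := by
  refine Ideal.isMaximal_iff.mpr ⟨fun h => one_ne_zero (α := K) h, fun J f hle hf hfJ => ?_⟩
  have hfx : f x ≠ 0 := hf
  let c : C(𝒪[K], K) := ContinuousMap.const _ (f x)⁻¹
  -- The constant `c` is chosen so that `c * f` equals 1 at `x`.
  have h : 1 - c * f ∈ J := hle (mem_vanishingIdealAt.mpr (by simp [c, hfx]))
  simpa using J.add_mem h (J.mul_mem_left c hfJ)

end LocalField

theorem corollary6p3 (K : Type*) [NormedField K] [ValuativeRel K] [IsNonarchimedeanLocalField K]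
    (P : Ideal C(𝒪[K], K)) (hprime : P.IsPrime)
    (hclosed : IsClosed[supNormTopology K] (P : Set C(𝒪[K], K))) :
    P.IsMaximal ∧ ∃ x : 𝒪[K], P = vanishingIdealAt x := by
  have := IsNonarchimedeanLocalField.totallyDisconnectedSpace K
  obtain ⟨x, hx⟩ := exists_forall_mem_of_isClosed_of_isPrime hprime hclosed
  have hmax := vanishingIdealAt_isMaximal x
  have heq : P = vanishingIdealAt x := (hmax.eq_of_le hprime.ne_top hx).symm
  exact ⟨heq ▸ hmax, x, heq⟩
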